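/- Let $F$ be a nonarchimedean two-dimensional local field: $F$ is the fraction field of a complete discrete valuation ring $\mathcal O_F$ whose residue field $\overline F$ is itself the fraction field of a complete discrete valuation ring $\mathcal O_{\overline F}$ with finite residue field of $q$ elements. Let $O_F=\{x\in\mathcal O_F : \bar x\in\mathcal O_{\overline F}\}$ be the rank two ring of integers, and let $t_1,t_2$ be local parameters, i.e. $t_2$ is a uniformiser of $\mathcal O_F$ and $t_1\in\mathcal O_F$ has residue a uniformiser of $\mathcal O_{\overline F}$. Let $m\ge 1$, order $\mathbb Z^2$ lexicographically from the right (so $(i,j)>(0,0)$ means $j>0$, or $j=0$ and $i>0$), and for $(i,j)>(0,0)$ put $$K_{i,j}=I_m+t_1^it_2^jM_m(O_F)\subset \mathrm{GL}_m(F),\qquad \widetilde K_{i,j}=K_{i,j}\cap \mathrm{SL}_m(F).$$ Let $\mathcal R$ be the smallest ring of subsets of $\mathrm{SL}_m(F)$ containing all left translates $g\widetilde K_{i,j}$ with $g\in \mathrm{SL}_m(F)$ and $(i,j)>(0,0)$ (the ring of ddd-sets). Theorem. For every $\lambda\in\mathbb R(\!(X)\!)^\times$, the assignment $$\mu(g\widetilde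 K_{i,j})=\lambda\, q^{-(m^2-1)i}X^{(m^2-1)j}\qquad (g\in \mathrm{SL}_m(F),\ (i,j)>(0,0))$$ is well defined and extends uniquely to a finitely additive function $\mu:\mathcal R\to\mathbb R(\!(X)\!)$ with $\mu(\emptyset)=0$. Moreover $\mathcal R$ is stable under left translation by $\mathrm{SL}_m(F)$, and $\mu$ is left-invariant: $\mu(gA)=\mu(A)$ for all $g\in \mathrm{SL}_m(F)$ and $A\in\mathcal R$. -/

import Mathlib

open scoped Pointwise

/-- The valuation subring `O` of the field `K` is the ring of integers of a complete discrete
valuation on `K`. -/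
structure IsCompleteDiscrete {K : Type*} [Field K] (O : ValuationSubring K) : Prop where
  dvr : IsDiscreteValuationRing O
  complete : IsAdicComplete (IsLocalRing.maximalIdeal O) O

/-- The structure of a (nonarchimedean) two-dimensional local field on a field `F`: a complete
discrete valuation on `F`, and a complete discrete valuation with finite residue field on the
residue field of `F`. -/
structure TwoDimLocalField (F : Type*) [Field F] where
  /-- the rank one ring of integers of `F` -/
  integers : ValuationSubring F
  integers_complete : IsCompleteDiscrete integers
  /-- the ring of integers of the residue field of `F` -/
  resIntegers : ValuationSubring (IsLocalRing.ResidueField integers)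
  resIntegers_complete : IsCompleteDiscrete resIntegers
  finite_residue : Finite (IsLocalRing.ResidueField resIntegers)

namespace TwoDimLocalField

variable {F : Type*} [Field F] (T : TwoDimLocalField F)

/-- The rank two ring of integers: the rank one integers whose residue is again an integer. -/
def rankTwoIntegers : Subring F :=
  (T.resIntegers.toSubring.comap (IsLocalRing.residue T.integers)).map T.integers.subtype

/-- The number of elements of the last residue field. -/
noncomputable def q : ℕ := Nat.card (IsLocalRing.ResidueField T.resIntegers)

/-- `t₁, t₂` is a system of local parameters of `F`: `t₂` is a uniformiser of the rank one ring of
integers, and `t₁` is a unit of it that lifts a uniformiser of the residue field. -/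
structure IsLocalParameters (t₁ t₂ : F) : Prop where
  uniformiser : ∃ p : T.integers, Irreducible p ∧ (p : F) = t₂
  lift : ∃ u : T.integers, (u : F) = t₁ ∧
    ∃ p : T.resIntegers, Irreducible p ∧ IsLocalRing.residue T.integers u = p

/-- `K_{i,j} = I_m + t₁^i t₂^j M_m(O_F)`, as a subset of `GL_m(F)`. -/
def congruenceSet (m : ℕ) (t₁ t₂ : F) (i j : ℤ) : Set (Matrix.GeneralLinearGroup (Fin m) F) :=
  {g | ∃ A : Matrix (Fin m) (Fin m) F, (∀ r s, A r s ∈ T.rankTwoIntegers) ∧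
    (g : Matrix (Fin m) (Fin m) F) = 1 + (t₁ ^ i * t₂ ^ j) • A}

/-- `K_{i,j} ∩ SL_m(F)`, as a subset of `SL_m(F)`. -/
def congruenceSetSL (m : ℕ) (t₁ t₂ : F) (i j : ℤ) :
    Set (Matrix.SpecialLinearGroup (Fin m) F) :=
  Matrix.SpecialLinearGroup.toGL ⁻¹' T.congruenceSet m t₁ t₂ i j

/-- `(i, j) > (0, 0)` in the order on `ℤ²` that is lexicographic from the right. -/
def PosIndex (i j : ℤ) : Prop := toLex ((0 : ℤ), (0 : ℤ)) < toLex (j, i)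

/-- The nonempty distinguished subsets of `SL_m(F)`: the left translates of the sets
`K_{i,j} ∩ SL_m(F)` with `(i, j) > (0, 0)`. -/
def distinguishedSets (m : ℕ) (t₁ t₂ : F) : Set (Set (Matrix.SpecialLinearGroup (Fin m) F)) :=
  {D | ∃ (g : Matrix.SpecialLinearGroup (Fin m) F) (i j : ℤ),
    PosIndex i j ∧ D = g • T.congruenceSetSL m t₁ t₂ i j}

end TwoDimLocalField

/-- The smallest ring of sets that contains the family `S`. -/
def generatedSetRing {α : Type*} (S : Set (Set α)) : Set (Set α) :=
  {A | ∀ C : Set (Set α), MeasureTheory.IsSetRing C → S ⊆ C → A ∈ C}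

theorem isSetRing_generatedSetRing {α : Type*} (S : Set (Set α)) :
    MeasureTheory.IsSetRing (generatedSetRing S) where
  empty_mem := fun _ hC _ => hC.empty_mem
  union_mem := fun _ _ hs ht C hC hS => hC.union_mem (hs C hC hS) (ht C hC hS)
  sdiff_mem := fun _ _ hs ht C hC hS => hC.sdiff_mem (hs C hC hS) (ht C hC hS)

/-- The ddd-sets of `SL_m(F)`: the smallest ring of sets containing the distinguished sets. -/
def TwoDimLocalField.dddSets {F : Type*} [Field F] (T : TwoDimLocalField F) (m : ℕ) (t₁ t₂ : F) :
    Set (Set (Matrix.SpecialLinearGroup (Fin m) F)) :=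
  generatedSetRing (T.distinguishedSets m t₁ t₂)

/-! The groups `K_{i,j} ∩ SL_m(F)` form a chain, so two cosets of members of the chain are disjoint
or nested. A value on cosets that depends only on the subgroup extends to a content as soon as it is
compatible with every finite index in the chain; an infinite index imposes nothing, because no
finite union of smaller cosets fills a larger one.

Existence: each ddd-set has an indicator function that is a finite integral combination of
indicators of cosets, and its measure is the same combination of weights. `sum_degree_smul_eq_zero`
shows that this does not depend on the combination. Uniqueness: the ring is generated from cosets by
disjoint unions and proper differences alone, both of which additivity controls. Invariance follows
from uniqueness.

The arithmetic input is `relIndex_principal_mul`: reducing `A` in `1 + τA` to the last residue field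
identifies the quotient of successive groups with the trace-zero matrices, so raising `i` by one
costs index `q^(m²-1)`. Raising `j` passes through infinitely many such steps, so for `m ≥ 2` the
index is infinite and `X` can be a free variable. -/

/-! ### Rings of sets and uniqueness of contents -/

/-- The sets obtained from members of `S` by disjoint unions and proper differences. -/
inductive DisjointlyGenerated {α : Type*} (S : Set (Set α)) : Set α → Prop
  | empty : DisjointlyGenerated S ∅
  | base {A : Set α} : A ∈ S → DisjointlyGenerated S A
  | disjUnion {A B : Set α} : DisjointlyGenerated S A → DisjointlyGenerated S B → Disjoint A B →
      DisjointlyGenerated S (A ∪ B)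
  | diff {A B : Set α} : DisjointlyGenerated S A → DisjointlyGenerated S B → B ⊆ A →
      DisjointlyGenerated S (A \ B)

namespace DisjointlyGenerated

variable {α : Type*} {S : Set (Set α)}

theorem mem_generatedSetRing {A : Set α} (hA : DisjointlyGenerated S A) :
    A ∈ generatedSetRing S := by
  induction hA with
  | empty => exact (isSetRing_generatedSetRing S).empty_mem
  | base h => exact fun C _ hS => hS h
  | disjUnion _ _ _ h₁ h₂ => exact (isSetRing_generatedSetRing S).union_mem h₁ h₂
  | diff _ _ _ h₁ h₂ => exact (isSetRing_generatedSetRing S).sdiff_mem h₁ h₂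

theorem inter (hS : ∀ A ∈ S, ∀ B ∈ S, A ∩ B = ∅ ∨ A ∩ B ∈ S) {A B : Set α}
    (hA : DisjointlyGenerated S A) (hB : DisjointlyGenerated S B) :
    DisjointlyGenerated S (A ∩ B) := by
  induction hB with
  | empty => simpa using empty
  | @base B hB =>
    induction hA with
    | empty => simpa using empty
    | @base A hA =>
      rcases hS A hA B hB with h | h
      · rw [h]; exact empty
      · exact base h
    | disjUnion _ _ hd h₁ h₂ =>
      rw [Set.union_inter_distrib_right]
      exact disjUnion h₁ h₂ (hd.mono Set.inter_subset_left Set.inter_subset_left)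
    | @diff A₁ A₂ _ _ hd h₁ h₂ =>
      rw [show (A₁ \ A₂) ∩ B = (A₁ ∩ B) \ (A₂ ∩ B) by ext; simp; tauto]
      exact diff h₁ h₂ (Set.inter_subset_inter_left _ hd)
  | disjUnion _ _ hd h₁ h₂ =>
    rw [Set.inter_union_distrib_left]
    exact disjUnion h₁ h₂ (hd.mono Set.inter_subset_right Set.inter_subset_right)
  | @diff B₁ B₂ _ _ hd h₁ h₂ =>
    rw [show A ∩ (B₁ \ B₂) = (A ∩ B₁) \ (A ∩ B₂) by ext; simp; tauto]
    exact diff h₁ h₂ (Set.inter_subset_inter_right _ hd)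

/-- The disjointly generated sets already form a ring: `A \ B = A \ (A ∩ B)` is a proper difference,
and `A ∪ B` is the disjoint union of `A` and `B \ A`. -/
theorem of_mem_generatedSetRing (hS : ∀ A ∈ S, ∀ B ∈ S, A ∩ B = ∅ ∨ A ∩ B ∈ S) {A : Set α}
    (hA : A ∈ generatedSetRing S) : DisjointlyGenerated S A := by
  have sdiff : ∀ {A B : Set α}, DisjointlyGenerated S A → DisjointlyGenerated S B →
      DisjointlyGenerated S (A \ B) := fun {A B} hA hB => by
    rw [← Set.sdiff_self_inter]
    exact diff hA (inter hS hA hB) Set.inter_subset_left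
  refine hA {A | DisjointlyGenerated S A} ⟨empty, fun A B hA hB => ?_, fun A B => sdiff⟩
    fun A => base
  rw [← Set.union_sdiff_self]
  exact disjUnion hA (sdiff hB hA) Set.disjoint_sdiff_right

end DisjointlyGenerated

/-- Two contents on a ring generated by a family that is closed under nonempty intersections agree
if they agree on the family. -/
theorem addContent_eq_of_eq_on_generators {α M : Type*} [AddCommGroup M] {S : Set (Set α)}
    (hS : ∀ A ∈ S, ∀ B ∈ S, A ∩ B = ∅ ∨ A ∩ B ∈ S)
    (μ ν : MeasureTheory.AddContent M (generatedSetRing S)) (h : ∀ A ∈ S, ν A = μ A)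
    {A : Set α} (hA : A ∈ generatedSetRing S) : ν A = μ A := by
  have hR := isSetRing_generatedSetRing S
  have hA' := DisjointlyGenerated.of_mem_generatedSetRing hS hA
  clear hA
  induction hA' with
  | empty => simp
  | base hA => exact h _ hA
  | disjUnion hA hB hd h₁ h₂ =>
    rw [MeasureTheory.addContent_union hR hA.mem_generatedSetRing hB.mem_generatedSetRing hd,
      MeasureTheory.addContent_union hR hA.mem_generatedSetRing hB.mem_generatedSetRing hd, h₁, h₂]
  | @diff A B hA hB hd h₁ h₂ =>
    have key : ∀ ξ : MeasureTheory.AddContent M (generatedSetRing S), ξ A = ξ B + ξ (A \ B) := by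
      intro ξ
      rw [← MeasureTheory.addContent_union hR hB.mem_generatedSetRing
        (hR.sdiff_mem hA.mem_generatedSetRing hB.mem_generatedSetRing) Set.disjoint_sdiff_right,
        Set.union_sdiff_cancel hd]
    have h₃ := key ν
    rw [h₁, h₂, key μ] at h₃
    exact (add_left_cancel h₃).symm

/-! ### Invariant contents from a chain of subgroups -/

namespace SubgroupChain

variable {G Γ M : Type*} [Group G] [AddCommGroup M]

/-- The left cosets of the members of a family of subgroups. -/
def cosets (H : Γ → Subgroup G) : Set (Set G) := {D | ∃ (g : G) (γ : Γ), D = g • (H γ : Set G)}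

theorem smul_coset_eq_of_mem {H : Subgroup G} {g x : G} (hx : x ∈ g • (H : Set G)) :
    g • (H : Set G) = x • (H : Set G) := by
  rw [leftCoset_eq_iff]
  exact (mem_leftCoset_iff g).1 hx

theorem smul_mem_generatedSetRing (H : Γ → Subgroup G) (g : G) {A : Set G}
    (hA : A ∈ generatedSetRing (cosets H)) : g • A ∈ generatedSetRing (cosets H) := by
  have hR := isSetRing_generatedSetRing (cosets H)
  refine hA {A | g • A ∈ generatedSetRing (cosets H)} ⟨?_, fun A B hA hB => ?_, fun A B hA hB => ?_⟩
    ?_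
  · simpa using hR.empty_mem
  · rw [Set.mem_ofPred_eq, Set.smul_set_union]
    exact hR.union_mem hA hB
  · rw [Set.mem_ofPred_eq, Set.smul_set_sdiff]
    exact hR.sdiff_mem hA hB
  · rintro _ ⟨g', γ, rfl⟩ C _ hC
    exact hC ⟨g * g', γ, smul_smul _ _ _⟩

variable [LinearOrder Γ]

/-- Cosets that meet can be based at a common point, and are then nested because the subgroups are.
-/
theorem inter_cosets {H : Γ → Subgroup G} (hH : Antitone H) (A : Set G) (hA : A ∈ cosets H)
    (B : Set G) (hB : B ∈ cosets H) : A ∩ B = ∅ ∨ A ∩ B ∈ cosets H := by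
  obtain ⟨g, γ, rfl⟩ := hA
  obtain ⟨g', γ', rfl⟩ := hB
  rcases Set.eq_empty_or_nonempty (g • (H γ : Set G) ∩ g' • (H γ' : Set G)) with h | ⟨x, hx, hx'⟩
  · exact Or.inl h
  · right
    rw [smul_coset_eq_of_mem hx, smul_coset_eq_of_mem hx']
    rcases le_total γ γ' with h | h
    · exact ⟨x, γ', Set.inter_eq_right.2 (Set.smul_set_mono (hH h))⟩
    · exact ⟨x, γ, Set.inter_eq_left.2 (Set.smul_set_mono (hH h))⟩

theorem quotientEquivProdOfLE_mk_fst {K L : Subgroup G} (h : K ≤ L) (x : G) :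
    (Subgroup.quotientEquivProdOfLE h (QuotientGroup.mk x)).1 = QuotientGroup.mk x := rfl

/-- Cosets of a subgroup decompose into cosets of a subgroup of finite index. -/
theorem exists_refinement {K L : Subgroup G} (h : K ≤ L) (hfin : K.relIndex L ≠ 0)
    (f : G ⧸ L →₀ ℤ) : ∃ f' : G ⧸ K →₀ ℤ, (∀ x : G, f' x = f x) ∧
      f'.degree = K.relIndex L • f.degree := by
  classical
  let e := Subgroup.quotientEquivProdOfLE h
  have : (K.subgroupOf L).FiniteIndex := ⟨hfin⟩
  cases nonempty_fintype (L ⧸ K.subgroupOf L)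
  -- Each coset of `L` is replaced by the sum of all cosets of `K` inside it, indexed by `L / K`.
  refine ⟨∑ u, f.mapDomain (fun z => e.symm (z, u)), fun x => ?_, ?_⟩
  · rw [Finsupp.finsetSum_apply, Finset.sum_eq_single (e x).2]
    · have hinj : Function.Injective fun z => e.symm (z, (e x).2) := fun z z' hz => by
        simpa using hz
      have hx := Finsupp.mapDomain_apply hinj f (x : G ⧸ L)
      rwa [show e.symm ((x : G ⧸ L), (e x).2) = x from e.symm_apply_apply x] at hx
    · intro u _ hu
      refine Finsupp.mapDomain_of_notMem_range _ _ ?_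
      rintro ⟨z, hz⟩
      apply hu
      rw [← hz]
      simp
    · simp
  · rw [map_sum]
    simp only [Finsupp.degree_mapDomain]
    rw [Finset.sum_const, Finset.card_univ, Subgroup.relIndex, Subgroup.index, Nat.card_eq_fintype_card]

/-- A nonzero value would be repeated on the infinitely many cosets of `K` inside one coset of `L`,
against finite support. -/
theorem eq_zero_of_infinite_relIndex {K L : Subgroup G} (h : K ≤ L) (hinf : K.relIndex L = 0)
    (f : G ⧸ K →₀ ℤ) (hf : ∀ x y : G, (x : G ⧸ L) = y → f x = f y) : f = 0 := by
  let e := Subgroup.quotientEquivProdOfLE h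
  have hI : Infinite (L ⧸ K.subgroupOf L) := Subgroup.index_eq_zero_iff_infinite.1 hinf
  ext y
  induction y using QuotientGroup.induction_on with
  | H x =>
  by_contra hx
  have hmem : ∀ u : L ⧸ K.subgroupOf L, e.symm ((x : G ⧸ L), u) ∈ f.support := by
    intro u
    obtain ⟨y, hy⟩ := QuotientGroup.mk_surjective (e.symm ((x : G ⧸ L), u))
    have : (y : G ⧸ L) = x := by
      rw [← quotientEquivProdOfLE_mk_fst h y, hy]
      exact congrArg Prod.fst (e.apply_symm_apply _)
    rw [← hy, Finsupp.mem_support_iff, hf y x this]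
    exact hx
  refine not_injective_infinite_finite (fun u => (⟨_, hmem u⟩ : f.support)) fun u u' huu => ?_
  simpa using congrArg Subtype.val huu

/-- The weights respect every linear relation between indicator functions of cosets. -/
theorem sum_degree_smul_eq_zero {H : Γ → Subgroup G} (hH : Antitone H) {w : Γ → M}
    (hw : ∀ γ γ', γ ≤ γ' → (H γ').relIndex (H γ) ≠ 0 → w γ = (H γ').relIndex (H γ) • w γ')
    (s : Finset Γ) (f : ∀ γ, G ⧸ H γ →₀ ℤ) (hf : ∀ x : G, ∑ γ ∈ s, f γ x = 0) :
    ∑ γ ∈ s, (f γ).degree • w γ = 0 := by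
  -- Induction on the number of levels: the smallest subgroup `H a` is compared with the next one,
  -- `H b`.
  induction hn : s.card generalizing s f with
  | zero => simp [Finset.card_eq_zero.1 hn]
  | succ n ih =>
  have hs : s.Nonempty := Finset.card_pos.1 (by omega)
  set a := s.max' hs
  have ha : a ∈ s := s.max'_mem hs
  have hcard : (s.erase a).card = n := by rw [Finset.card_erase_of_mem ha]; omega
  by_cases hfa : f a = 0
  · rw [← Finset.add_sum_erase _ _ ha, hfa]
    simp only [map_zero, zero_smul, zero_add]
    refine ih _ f (fun x => ?_) hcard
    rw [← hf x, ← Finset.add_sum_erase _ _ ha, hfa]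
    simp
  · have hs' : (s.erase a).Nonempty := by
      by_contra hne
      rw [Finset.not_nonempty_iff_eq_empty] at hne
      apply hfa
      ext y
      induction y using QuotientGroup.induction_on with
      | H x =>
      have := hf x
      rw [← Finset.add_sum_erase _ _ ha, hne] at this
      simpa using this
    set b := (s.erase a).max' hs'
    have hb : b ∈ s.erase a := Finset.max'_mem _ hs'
    have hba : b ≤ a := s.le_max' _ (Finset.mem_of_mem_erase hb)
    have hab : a ∈ s.erase b := Finset.mem_erase.2 ⟨(Finset.ne_of_mem_erase hb).symm, ha⟩
    have hcomm : (s.erase b).erase a = (s.erase a).erase b := Finset.erase_right_comm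
    by_cases hfin : (H a).relIndex (H b) = 0
    -- By the relation, `f a` is minus a sum of functions that are constant on cosets of `H b`,
    -- since every other subgroup involved contains `H b`. Infinite index then forces `f a = 0`.
    · refine absurd (eq_zero_of_infinite_relIndex (hH hba) hfin (f a) fun x y hxy => ?_) hfa
      have key : ∀ x : G, f a x = -∑ γ ∈ s.erase a, f γ x := fun x => by
        rw [eq_neg_iff_add_eq_zero, Finset.add_sum_erase _ (fun γ => f γ x) ha, hf x]
      rw [key, key]
      congr 1
      refine Finset.sum_congr rfl fun γ hγ => ?_
      congr 1
      rw [QuotientGroup.eq] at hxy ⊢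
      exact hH (Finset.le_max' _ _ hγ) hxy
    -- With finite index, the terms at level `b` are rewritten at level `a`; `hw` says that this
    -- preserves the weight, and level `b` disappears.
    · obtain ⟨f', hf', hdeg⟩ := exists_refinement (hH hba) hfin (f b)
      classical
      have h := ih (s.erase b) (Function.update f a (f a + f')) (fun x => ?_)
        (by rw [Finset.card_erase_of_mem (Finset.mem_of_mem_erase hb)]; omega)
      · rw [← Finset.add_sum_erase _ _ hab, hcomm] at h
        rw [← Finset.add_sum_erase _ _ ha, ← Finset.add_sum_erase _ _ hb, ← h,
          Function.update_self, map_add, hdeg, add_smul, hw b a hba hfin, add_assoc]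
        congr 1
        congr 1
        · rw [smul_assoc, smul_comm]
        · refine Finset.sum_congr rfl fun γ hγ => ?_
          rw [Function.update_of_ne (by simp at hγ; tauto)]
      · rw [← hf x, ← Finset.add_sum_erase _ _ hab, hcomm, ← Finset.add_sum_erase _ _ ha,
          ← Finset.add_sum_erase _ _ hb, Function.update_self, Finsupp.add_apply, hf', add_assoc]
        congr 1
        congr 1
        refine Finset.sum_congr rfl fun γ hγ => ?_
        rw [Function.update_of_ne (by simp at hγ; tauto)]

section content

/-- The function on `G` given by a formal combination of cosets. -/
noncomputable def evalHom (H : Γ → Subgroup G) (x : G) : (Π₀ γ, G ⧸ H γ →₀ ℤ) →+ ℤ :=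
  DFinsupp.sumAddHom fun γ => Finsupp.applyAddHom (x : G ⧸ H γ)

/-- The weight of a formal combination of cosets. -/
noncomputable def weightHom (H : Γ → Subgroup G) (w : Γ → M) : (Π₀ γ, G ⧸ H γ →₀ ℤ) →+ M :=
  DFinsupp.sumAddHom fun γ =>
    ((smulAddHom ℤ M).flip (w γ)).comp (Finsupp.degree : (G ⧸ H γ →₀ ℤ) →+ ℤ)

theorem weightHom_eq_of_evalHom_eq {H : Γ → Subgroup G} (hH : Antitone H) {w : Γ → M}
    (hw : ∀ γ γ', γ ≤ γ' → (H γ').relIndex (H γ) ≠ 0 → w γ = (H γ').relIndex (H γ) • w γ')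
    {f f' : Π₀ γ, G ⧸ H γ →₀ ℤ} (h : ∀ x, evalHom H x f = evalHom H x f') :
    weightHom H w f = weightHom H w f' := by
  classical
  rw [← sub_eq_zero, ← map_sub]
  have h' : ∀ x, evalHom H x (f - f') = 0 := fun x => by rw [map_sub, h x, sub_self]
  simp only [evalHom, weightHom, DFinsupp.sumAddHom_apply, DFinsupp.sum] at h' ⊢
  exact sum_degree_smul_eq_zero hH hw _ _ h'

/-- `f` is a formal combination of cosets that represents the indicator function of `A`. -/
def Represents (H : Γ → Subgroup G) (f : Π₀ γ, G ⧸ H γ →₀ ℤ) (A : Set G) : Prop :=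
  ∀ x, evalHom H x f = A.indicator 1 x

theorem represents_coset (H : Γ → Subgroup G) (g : G) (γ : Γ) :
    Represents H (DFinsupp.single γ (Finsupp.single (g : G ⧸ H γ) 1)) (g • (H γ : Set G)) := by
  classical
  intro x
  have : x ∈ g • (H γ : Set G) ↔ (g : G ⧸ H γ) = x := by
    rw [mem_leftCoset_iff, QuotientGroup.eq]; rfl
  rw [evalHom]
  simp only [Set.indicator_apply, this, Pi.one_apply]
  trans (Finsupp.single (g : G ⧸ H γ) (1 : ℤ)) x
  · exact DFinsupp.sumAddHom_single (fun γ => Finsupp.applyAddHom (x : G ⧸ H γ)) γ _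
  · rw [Finsupp.single_apply]

theorem Represents.disjUnion {H : Γ → Subgroup G} {f f' : Π₀ γ, G ⧸ H γ →₀ ℤ} {A B : Set G}
    (hf : Represents H f A) (hf' : Represents H f' B) (hd : Disjoint A B) :
    Represents H (f + f') (A ∪ B) := fun x => by
  rw [map_add, hf, hf', Set.indicator_union_of_disjoint hd]

theorem exists_represents {H : Γ → Subgroup G} (hH : Antitone H) {A : Set G}
    (hA : A ∈ generatedSetRing (cosets H)) : ∃ f, Represents H f A := by
  classical
  have hA' := DisjointlyGenerated.of_mem_generatedSetRing (inter_cosets hH) hA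
  clear hA
  induction hA' with
  | empty => exact ⟨0, fun x => by simp⟩
  | base hA =>
    obtain ⟨g, γ, rfl⟩ := hA
    exact ⟨_, represents_coset H g γ⟩
  | disjUnion _ _ hd h₁ h₂ =>
    obtain ⟨f₁, h₁⟩ := h₁
    obtain ⟨f₂, h₂⟩ := h₂
    exact ⟨_, h₁.disjUnion h₂ hd⟩
  | diff _ _ hd h₁ h₂ =>
    obtain ⟨f₁, h₁⟩ := h₁
    obtain ⟨f₂, h₂⟩ := h₂
    exact ⟨f₁ - f₂, fun x => by rw [map_sub, h₁, h₂, Set.indicator_sdiff hd, Pi.sub_apply]⟩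

open Classical in
/-- The weight of a set, by way of a representation of its indicator function. -/
noncomputable def weight (H : Γ → Subgroup G) (w : Γ → M) (A : Set G) : M :=
  if h : ∃ f, Represents H f A then weightHom H w h.choose else 0

theorem weight_eq {H : Γ → Subgroup G} (hH : Antitone H) {w : Γ → M}
    (hw : ∀ γ γ', γ ≤ γ' → (H γ').relIndex (H γ) ≠ 0 → w γ = (H γ').relIndex (H γ) • w γ')
    {f : Π₀ γ, G ⧸ H γ →₀ ℤ} {A : Set G} (hf : Represents H f A) :
    weight H w A = weightHom H w f := by
  have h : ∃ f, Represents H f A := ⟨f, hf⟩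
  rw [weight, dif_pos h]
  exact weightHom_eq_of_evalHom_eq hH hw fun x => by rw [h.choose_spec x, hf x]

theorem exists_addContent {H : Γ → Subgroup G} (hH : Antitone H) {w : Γ → M}
    (hw : ∀ γ γ', γ ≤ γ' → (H γ').relIndex (H γ) ≠ 0 → w γ = (H γ').relIndex (H γ) • w γ') :
    ∃ μ : MeasureTheory.AddContent M (generatedSetRing (cosets H)),
      ∀ (g : G) (γ : Γ), μ (g • (H γ : Set G)) = w γ := by
  classical
  refine ⟨(isSetRing_generatedSetRing (cosets H)).addContent_of_union (weight H w) ?_ ?_, ?_⟩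
  · rw [weight_eq hH hw (f := 0) fun x => by simp, map_zero]
  · intro A B hA hB hd
    obtain ⟨f, hf⟩ := exists_represents hH hA
    obtain ⟨f', hf'⟩ := exists_represents hH hB
    rw [weight_eq hH hw (hf.disjUnion hf' hd), weight_eq hH hw hf, weight_eq hH hw hf', map_add]
  · intro g γ
    change weight H w (g • (H γ : Set G)) = w γ
    rw [weight_eq hH hw (represents_coset H g γ), weightHom]
    trans (Finsupp.single (g : G ⧸ H γ) (1 : ℤ)).degree • w γ
    · exact DFinsupp.sumAddHom_single (fun γ =>
        ((smulAddHom ℤ M).flip (w γ)).comp (Finsupp.degree : (G ⧸ H γ →₀ ℤ) →+ ℤ)) γ _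
    · rw [Finsupp.degree_single, one_smul]

/-- The translate of `μ` is again a content with the same values on cosets, so uniqueness applies.
-/
theorem addContent_smul {H : Γ → Subgroup G} (hH : Antitone H) {w : Γ → M}
    {μ : MeasureTheory.AddContent M (generatedSetRing (cosets H))}
    (hμ : ∀ (g : G) (γ : Γ), μ (g • (H γ : Set G)) = w γ) (g : G) {A : Set G}
    (hA : A ∈ generatedSetRing (cosets H)) : μ (g • A) = μ A := by
  have hR := isSetRing_generatedSetRing (cosets H)
  refine addContent_eq_of_eq_on_generators (inter_cosets hH) μ
    (hR.addContent_of_union (fun A => μ (g • A)) ?_ ?_) ?_ hA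
  · simp
  · intro A B hA hB hd
    rw [Set.smul_set_union]
    exact MeasureTheory.addContent_union hR (smul_mem_generatedSetRing H g hA)
      (smul_mem_generatedSetRing H g hB) (Set.disjoint_smul_set.2 hd)
  · rintro _ ⟨g', γ, rfl⟩
    change μ (g • g' • (H γ : Set G)) = _
    rw [smul_smul, hμ, hμ]

end content

end SubgroupChain

/-! ### Indices of principal congruence subgroups -/

namespace Matrix.PrincipalCongruence

variable {R k : Type*} [CommRing R] [Field k] {m : ℕ}

/-- The elements of `SL_m(R)` that are congruent to the identity modulo `τ`. -/
def principal (m : ℕ) (τ : R) : Subgroup (SpecialLinearGroup (Fin m) R) :=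
  (SpecialLinearGroup.map (n := Fin m) (Ideal.Quotient.mk (Ideal.span {τ}))).ker

theorem mem_principal {τ : R} {g : SpecialLinearGroup (Fin m) R} :
    g ∈ principal m τ ↔ ∃ A : Matrix (Fin m) (Fin m) R, (g : Matrix (Fin m) (Fin m) R) = 1 + τ • A := by
  rw [principal, MonoidHom.mem_ker, SpecialLinearGroup.ext_iff]
  have key : ∀ r s, (SpecialLinearGroup.map (Ideal.Quotient.mk (Ideal.span {τ})) g) r s =
      (1 : SpecialLinearGroup (Fin m) (R ⧸ Ideal.span {τ})) r s ↔
      ∃ a, g r s - (1 : Matrix (Fin m) (Fin m) R) r s = τ * a := by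
    intro r s
    have h1 : (1 : SpecialLinearGroup (Fin m) (R ⧸ Ideal.span {τ})) r s =
        Ideal.Quotient.mk (Ideal.span {τ}) ((1 : Matrix (Fin m) (Fin m) R) r s) := by
      rw [SpecialLinearGroup.coe_one, one_apply, one_apply]
      split_ifs <;> simp
    rw [h1]
    change Ideal.Quotient.mk _ (g r s) = _ ↔ _
    rw [Ideal.Quotient.eq, Ideal.mem_span_singleton]
    rfl
  simp only [key]
  constructor
  · intro h
    choose A hA using h
    refine ⟨Matrix.of A, ?_⟩
    ext r s
    simp [← hA]
  · rintro ⟨A, hA⟩ r s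
    exact ⟨A r s, by rw [hA]; simp⟩

theorem principal_anti {τ τ' : R} (h : τ ∣ τ') : principal m τ' ≤ principal m τ := by
  obtain ⟨a, rfl⟩ := h
  intro g hg
  obtain ⟨A, hA⟩ := mem_principal.1 hg
  exact mem_principal.2 ⟨a • A, by rw [hA, mul_smul]⟩

theorem card_ker_trace [Finite k] (hm : 1 ≤ m) :
    Nat.card (traceAddMonoidHom (Fin m) k).ker = Nat.card k ^ (m ^ 2 - 1) := by
  have h := AddSubgroup.card_mul_index (traceAddMonoidHom (Fin m) k).ker
  have hsurj : Function.Surjective (traceAddMonoidHom (Fin m) k) := fun a =>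
    ⟨Matrix.single ⟨0, hm⟩ ⟨0, hm⟩ a, by simp⟩
  rw [AddSubgroup.index_ker, AddMonoidHom.range_eq_top.2 hsurj, AddSubgroup.card_top] at h
  have hM : Nat.card (Matrix (Fin m) (Fin m) k) = Nat.card k ^ (m ^ 2) := by
    simp only [Matrix, Nat.card_fun, Nat.card_eq_fintype_card (α := Fin m), Fintype.card_fin]
    rw [← pow_mul, sq]
  rw [hM] at h
  have hm2 : m ^ 2 = m ^ 2 - 1 + 1 := by have := Nat.one_le_pow 2 m hm; omega
  rw [hm2, pow_succ] at h
  exact Nat.eq_of_mul_eq_mul_right Nat.card_pos h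

theorem exists_det_one_add_smul (τ : R) (A : Matrix (Fin m) (Fin m) R) :
    ∃ e, (1 + τ • A).det = 1 + τ * A.trace + τ ^ 2 * e :=
  ⟨_, by rw [det_one_add_smul, mul_comm τ, mul_comm (τ ^ 2)]⟩

variable {ρ : R →+* k} {π τ : R}

/-- The coefficient matrix `A` of an element `1 + τ A`. -/
noncomputable def coeff (g : principal m τ) : Matrix (Fin m) (Fin m) R :=
  (mem_principal.1 g.2).choose

theorem coe_eq_one_add_coeff (g : principal m τ) :
    ((g : SpecialLinearGroup (Fin m) R) : Matrix (Fin m) (Fin m) R) = 1 + τ • coeff g :=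
  (mem_principal.1 g.2).choose_spec

variable [IsDomain R]

theorem coeff_eq (hτ : τ ≠ 0) {g : principal m τ} {A : Matrix (Fin m) (Fin m) R}
    (h : ((g : SpecialLinearGroup (Fin m) R) : Matrix (Fin m) (Fin m) R) = 1 + τ • A) :
    coeff g = A := by
  rw [coe_eq_one_add_coeff, add_right_inj] at h
  exact smul_right_injective _ hτ h

/-- The reduction of the coefficient matrix. -/
noncomputable def coeffHom (m : ℕ) (hτ : τ ≠ 0) (hρτ : ρ τ = 0) :
    principal m τ →* Multiplicative (Matrix (Fin m) (Fin m) k) where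
  toFun g := Multiplicative.ofAdd ((coeff g).map ρ)
  map_one' := by
    rw [coeff_eq hτ (A := 0) (by simp)]
    simp
  map_mul' g h := by
    rw [coeff_eq hτ (g := g * h) (A := coeff g + coeff h + τ • (coeff g * coeff h)), ← ofAdd_add]
    · congr 1
      ext r s
      simp [hρτ]
    · rw [Subgroup.coe_mul, SpecialLinearGroup.coe_mul, coe_eq_one_add_coeff,
        coe_eq_one_add_coeff, mul_add, add_mul, add_mul, smul_mul_smul_comm, mul_smul]
      simp only [one_mul, mul_one, smul_add]
      abel

theorem ker_coeffHom (hker : ∀ x, ρ x = 0 ↔ π ∣ x) (hτ : τ ≠ 0) (hρτ : ρ τ = 0) :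
    (coeffHom m hτ hρτ).ker = (principal m (τ * π)).subgroupOf (principal m τ) := by
  ext g
  rw [MonoidHom.mem_ker, Subgroup.mem_subgroupOf, mem_principal]
  change Multiplicative.ofAdd ((coeff g).map ρ) = 1 ↔ _
  rw [ofAdd_eq_one]
  constructor
  · intro h
    have h' : ∀ r s, π ∣ coeff g r s := fun r s => (hker _).1 (congrFun (congrFun h r) s)
    choose A hA using h'
    refine ⟨Matrix.of A, ?_⟩
    rw [coe_eq_one_add_coeff, mul_smul]
    congr 2
    ext r s
    simp [hA]
  · rintro ⟨A, hA⟩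
    rw [mul_smul] at hA
    rw [coeff_eq hτ hA]
    ext r s
    simp [(hker π).2 dvd_rfl]

/-- To first order `det (1 + τA)` is `1 + τ tr A`, so determinant one forces the reduced trace to
vanish. Conversely, a lift of a trace-zero matrix has determinant congruent to 1 modulo `τπ`, and
this error can be corrected without changing the reduction. -/
theorem mem_range_coeffHom (hm : 1 ≤ m) (hsurj : Function.Surjective ρ)
    (hunit : ∀ x, ρ x = 1 → IsUnit x)
    (hker : ∀ x, ρ x = 0 ↔ π ∣ x) (hτ : τ ≠ 0) (hρτ : ρ τ = 0) (N : Matrix (Fin m) (Fin m) k) :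
    Multiplicative.ofAdd N ∈ (coeffHom m hτ hρτ).range ↔ N.trace = 0 := by
  constructor
  · rintro ⟨g, hg⟩
    have hg' : (coeff g).map ρ = N := hg
    obtain ⟨e, he⟩ := exists_det_one_add_smul τ (coeff g)
    rw [← coe_eq_one_add_coeff, SpecialLinearGroup.det_coe] at he
    have h : τ * ((coeff g).trace + τ * e) = 0 := by linear_combination -he
    have h' := (mul_eq_zero.1 h).resolve_left hτ
    have h2 := congrArg ρ h'
    rw [map_add, map_mul, hρτ, zero_mul, add_zero, map_zero] at h2
    rw [← hg', ← h2]
    exact (AddMonoidHom.map_trace ρ.toAddMonoidHom _).symm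
  · intro hN
    choose lift hlift using hsurj
    set A : Matrix (Fin m) (Fin m) R := N.map lift
    have hA : A.map ρ = N := by ext r s; simp [A, hlift]
    have htr : ρ A.trace = 0 := by
      rw [← hN, ← hA]
      exact AddMonoidHom.map_trace ρ.toAddMonoidHom _
    obtain ⟨a, ha⟩ := (hker _).1 htr
    obtain ⟨t, ht⟩ := (hker _).1 hρτ
    obtain ⟨e, he⟩ := exists_det_one_add_smul τ A
    obtain ⟨u, hu⟩ := (hunit (1 + τ • A).det (by rw [he]; simp [hρτ])).exists_left_inv
    let i₀ : Fin m := ⟨0, hm⟩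
    -- Scaling the first row by the inverse `u` of the determinant makes the determinant 1.
    let d : Fin m → R := Function.update 1 i₀ u
    have hd : (diagonal d).det = u := by
      rw [det_diagonal, Finset.prod_update_of_mem (Finset.mem_univ _)]
      simp
    -- With `tr A = πa` and `τ = πt` the determinant is `1 + τπ(a + te)`, hence `u = 1 - τπ(a +
    -- te)u`. The factor `π` makes the correction invisible to `ρ`.
    have hd' : diagonal d = 1 + τ • (Matrix.single i₀ i₀ (-(π * (a + t * e) * u))) := by
      have hu1 : u = 1 - τ * (π * (a + t * e) * u) := by
        rw [he, ha] at hu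
        linear_combination hu - u * τ * e * ht
      ext r s
      by_cases hrs : r = s
      · subst hrs
        by_cases hr : r = i₀
        · subst hr
          simp only [d, diagonal_apply_eq, Function.update_self, add_apply, one_apply_eq, smul_apply,
            single_apply_same, smul_eq_mul]
          linear_combination hu1
        · simp [d, hr, Ne.symm hr]
      · have : ¬ (i₀ = r ∧ i₀ = s) := fun h => hrs (h.1.symm.trans h.2)
        simp [hrs, this]
    let E := Matrix.single i₀ i₀ (-(π * (a + t * e) * u))
    let B : SpecialLinearGroup (Fin m) R := ⟨diagonal d * (1 + τ • A), by rw [det_mul, hd, hu]⟩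
    have hB : (B : Matrix (Fin m) (Fin m) R) = 1 + τ • (A + E + τ • (E * A)) := by
      change diagonal d * (1 + τ • A) = _
      rw [hd', mul_add, add_mul, add_mul, smul_mul_smul_comm, mul_smul]
      simp only [one_mul, mul_one, smul_add]
      abel
    refine ⟨⟨B, mem_principal.2 ⟨_, hB⟩⟩, ?_⟩
    change Multiplicative.ofAdd ((coeff _).map ρ) = _
    rw [coeff_eq hτ hB, ← hA]
    congr 1
    have hE : E.map ρ = 0 := by
      ext r s
      simp only [E, map_apply, Matrix.single_apply, zero_apply]
      split_ifs <;> simp [(hker π).2 dvd_rfl]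
    ext r s
    have := congrFun (congrFun hE r) s
    simp only [map_apply, zero_apply] at this
    simp [hρτ, this]

/-- First isomorphism theorem for `coeffHom`: its kernel is the next congruence subgroup and its
image consists of the trace-zero matrices. -/
theorem relIndex_principal_mul [Finite k] (hm : 1 ≤ m) (hsurj : Function.Surjective ρ)
    (hunit : ∀ x, ρ x = 1 → IsUnit x) (hker : ∀ x, ρ x = 0 ↔ π ∣ x) (hτ : τ ≠ 0) (hρτ : ρ τ = 0) :
    (principal m (τ * π)).relIndex (principal m τ) = Nat.card k ^ (m ^ 2 - 1) := by
  rw [Subgroup.relIndex, ← ker_coeffHom hker hτ hρτ, Subgroup.index_ker, ← card_ker_trace hm]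
  refine Nat.card_congr (Multiplicative.toAdd.subtypeEquiv fun N => ?_)
  exact mem_range_coeffHom hm hsurj hunit hker hτ hρτ (Multiplicative.toAdd N)

end Matrix.PrincipalCongruence

/-! ### The rank two ring of integers and its local parameters -/

namespace TwoDimLocalField

open Matrix.PrincipalCongruence

variable {F : Type*} [Field F] (T : TwoDimLocalField F)

/-- The rank two ring of integers, as a subring of the rank one ring of integers. -/
def rankTwoSubring : Subring T.integers :=
  T.resIntegers.toSubring.comap (IsLocalRing.residue T.integers)

/-- The inclusion of the rank two ring of integers into the field. -/
def incl : T.rankTwoSubring →+* F := T.integers.subtype.comp T.rankTwoSubring.subtype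

theorem incl_injective : Function.Injective T.incl :=
  Subtype.val_injective.comp Subtype.val_injective

theorem mem_rankTwoIntegers {x : F} : x ∈ T.rankTwoIntegers ↔ ∃ y, T.incl y = x := by
  constructor
  · rintro ⟨y, hy, rfl⟩
    exact ⟨⟨y, hy⟩, rfl⟩
  · rintro ⟨y, rfl⟩
    exact ⟨y, y.2, rfl⟩

/-- The reduction of the rank two ring of integers to the residue field of `resIntegers`. -/
noncomputable def firstResidue : T.rankTwoSubring →+* T.resIntegers :=
  ((IsLocalRing.residue T.integers).comp T.rankTwoSubring.subtype).codRestrict T.resIntegers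
    fun x => x.2

/-- The reduction of the rank two ring of integers to the last residue field. -/
noncomputable def lastResidue : T.rankTwoSubring →+* IsLocalRing.ResidueField T.resIntegers :=
  (IsLocalRing.residue T.resIntegers).comp T.firstResidue

theorem lastResidue_surjective : Function.Surjective T.lastResidue := by
  intro z
  obtain ⟨y, rfl⟩ := IsLocalRing.residue_surjective z
  obtain ⟨x, hx⟩ := IsLocalRing.residue_surjective (y : IsLocalRing.ResidueField T.integers)
  refine ⟨⟨x, ?_⟩, ?_⟩
  · change IsLocalRing.residue _ x ∈ T.resIntegers
    rw [hx]; exact y.2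
  · exact congrArg (IsLocalRing.residue T.resIntegers) (Subtype.ext hx)

theorem isUnit_of_lastResidue_eq_one (x : T.rankTwoSubring) (hx : T.lastResidue x = 1) :
    IsUnit x := by
  have h1 : IsUnit (T.firstResidue x) := by
    rw [← IsLocalRing.residue_ne_zero_iff_isUnit]
    change T.lastResidue x ≠ 0
    rw [hx]; exact one_ne_zero
  obtain ⟨y, hy⟩ := h1.exists_right_inv
  have hy' : IsLocalRing.residue T.integers x * y = 1 := congrArg Subtype.val hy
  have h2 : IsUnit (x : T.integers) := by
    rw [← IsLocalRing.residue_ne_zero_iff_isUnit]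
    exact left_ne_zero_of_mul_eq_one hy'
  obtain ⟨z, hz⟩ := h2.exists_right_inv
  have hz' : IsLocalRing.residue T.integers z = y := by
    apply mul_left_cancel₀ (left_ne_zero_of_mul_eq_one hy')
    rw [hy', ← map_mul, hz, map_one]
  refine IsUnit.of_mul_eq_one ⟨z, ?_⟩ (Subtype.ext hz)
  change IsLocalRing.residue _ z ∈ T.resIntegers
  rw [hz']; exact y.2

theorem two_le_q : 2 ≤ T.q := by
  have := T.finite_residue
  exact Finite.one_lt_card

variable {T} {t₁ t₂ : F}

namespace IsLocalParameters

theorem exists_incl_eq_fst (ht : T.IsLocalParameters t₁ t₂) :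
    ∃ π : T.rankTwoSubring, T.incl π = t₁ ∧ IsUnit (π : T.integers) ∧
      ∀ x, T.lastResidue x = 0 ↔ π ∣ x := by
  have := T.resIntegers_complete.dvr
  obtain ⟨u, rfl, p, hp, hup⟩ := ht.lift
  have hp0 : (p : IsLocalRing.ResidueField T.integers) ≠ 0 := fun h => hp.ne_zero (Subtype.ext h)
  have hu : IsUnit u := by
    rw [← IsLocalRing.residue_ne_zero_iff_isUnit, hup]
    exact hp0
  have hmem : u ∈ T.rankTwoSubring := by
    change IsLocalRing.residue _ u ∈ T.resIntegers
    rw [hup]; exact p.2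
  have hπ : T.firstResidue ⟨u, hmem⟩ = p := Subtype.ext hup
  refine ⟨⟨u, hmem⟩, rfl, hu, fun x => ⟨fun hx => ?_, ?_⟩⟩
  · have h1 : T.firstResidue x ∈ IsLocalRing.maximalIdeal T.resIntegers :=
      (IsLocalRing.residue_eq_zero_iff _).1 hx
    rw [hp.maximalIdeal_eq, Ideal.mem_span_singleton] at h1
    obtain ⟨y, hy⟩ := h1
    have hy' : IsLocalRing.residue T.integers x = p * y := congrArg Subtype.val hy
    -- The parameter is a unit of the rank one ring, so the quotient exists there; its residue `y`
    -- is integral, which puts it in the rank two ring.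
    obtain ⟨v, hv⟩ := hu.exists_right_inv
    have hvx : IsLocalRing.residue T.integers (v * x) = y := by
      apply mul_left_cancel₀ hp0
      rw [← hy', ← hup, ← map_mul, ← mul_assoc, hv, one_mul]
    refine ⟨⟨v * x, ?_⟩, Subtype.ext ?_⟩
    · change IsLocalRing.residue _ (v * x) ∈ T.resIntegers
      rw [hvx]; exact y.2
    · change (x : T.integers) = u * (v * x)
      rw [← mul_assoc, hv, one_mul]
  · rintro ⟨y, rfl⟩
    rw [map_mul]
    change IsLocalRing.residue _ (T.firstResidue _) * _ = 0
    rw [hπ, (IsLocalRing.residue_eq_zero_iff p).2 ?_, zero_mul]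
    rw [hp.maximalIdeal_eq]
    exact Ideal.mem_span_singleton_self p

/-- For `j > 0` the exponent `i` may be negative: `t₁` is a unit of the rank one ring, and the
factor `t₂` makes the residue zero. -/
theorem exists_incl_eq (ht : T.IsLocalParameters t₁ t₂) {i j : ℤ} (h : 0 < j ∨ j = 0 ∧ 0 ≤ i) :
    ∃ τ, T.incl τ = t₁ ^ i * t₂ ^ j := by
  obtain ⟨π, rfl, hu, -⟩ := ht.exists_incl_eq_fst
  rcases h with hj | ⟨rfl, hi⟩
  · have := T.integers_complete.dvr
    obtain ⟨p, hp, rfl⟩ := ht.uniformiser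
    obtain ⟨n, rfl⟩ : ∃ n : ℕ, j = n + 1 := ⟨(j - 1).toNat, by omega⟩
    obtain ⟨U, hU⟩ := hu
    have hUi : (((U ^ i : T.integersˣ) : T.integers) : F) = (T.incl π) ^ i := by
      have h1 := map_zpow (Units.map (T.integers.subtype : T.integers →* F)) U i
      have h2 := congrArg Units.val h1
      rw [Units.val_zpow_eq_zpow_val] at h2
      change (((U ^ i : T.integersˣ) : T.integers) : F) = ((U : T.integers) : F) ^ i at h2
      rw [h2, hU]
      rfl
    refine ⟨⟨(U ^ i : T.integersˣ) * p ^ (n + 1), ?_⟩, ?_⟩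
    · change IsLocalRing.residue _ _ ∈ T.resIntegers
      rw [map_mul, map_pow, (IsLocalRing.residue_eq_zero_iff p).2, zero_pow (by omega), mul_zero]
      · exact T.resIntegers.zero_mem
      · rw [hp.maximalIdeal_eq]
        exact Ideal.mem_span_singleton_self p
    · change ((((U ^ i : T.integersˣ) : T.integers) * p ^ (n + 1) : T.integers) : F) = _
      push_cast
      rw [hUi]
      norm_cast
  · lift i to ℕ using hi
    exact ⟨π ^ i, by simp⟩

theorem fst_ne_zero (ht : T.IsLocalParameters t₁ t₂) : t₁ ≠ 0 := by
  obtain ⟨π, rfl, hu, -⟩ := ht.exists_incl_eq_fst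
  exact fun h => hu.ne_zero (Subtype.ext h)

theorem snd_ne_zero (ht : T.IsLocalParameters t₁ t₂) : t₂ ≠ 0 := by
  obtain ⟨p, hp, rfl⟩ := ht.uniformiser
  exact fun h => hp.ne_zero (Subtype.ext h)

end IsLocalParameters

theorem posIndex_iff {i j : ℤ} : PosIndex i j ↔ 0 < j ∨ j = 0 ∧ 0 < i := by
  rw [PosIndex, Prod.Lex.toLex_lt_toLex]
  simp only [eq_comm]

theorem coe_map_principal {m : ℕ} {i j : ℤ} {τ : T.rankTwoSubring}
    (hτ : T.incl τ = t₁ ^ i * t₂ ^ j) :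
    ((principal m τ).map (Matrix.SpecialLinearGroup.map T.incl) :
      Set (Matrix.SpecialLinearGroup (Fin m) F)) = T.congruenceSetSL m t₁ t₂ i j := by
  have hmap : ∀ A : Matrix (Fin m) (Fin m) T.rankTwoSubring,
      (1 + τ • A).map T.incl = 1 + (t₁ ^ i * t₂ ^ j) • A.map T.incl := by
    intro A
    ext r s
    rw [← hτ]
    simp [Matrix.one_apply, apply_ite]
  ext g
  constructor
  · rintro ⟨g, hg, rfl⟩
    obtain ⟨A, hA⟩ := mem_principal.1 hg
    refine ⟨A.map T.incl, fun r s => T.mem_rankTwoIntegers.2 ⟨_, rfl⟩, ?_⟩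
    rw [← hmap, ← hA]
    rfl
  · rintro ⟨A, hA, hg⟩
    choose B hB using fun r s => T.mem_rankTwoIntegers.1 (hA r s)
    have hAB : A = (Matrix.of B).map T.incl := by ext r s; exact (hB r s).symm
    have hg' : (g : Matrix (Fin m) (Fin m) F) = (1 + τ • Matrix.of B).map T.incl := by
      rw [hmap, ← hAB]; exact hg
    -- The determinant is 1 over `F`, and the inclusion is injective.
    have hdet : (1 + τ • Matrix.of B).det = 1 := by
      apply T.incl_injective
      rw [RingHom.map_det, map_one, ← g.det_coe, hg']
      rfl
    exact ⟨⟨_, hdet⟩, mem_principal.2 ⟨_, rfl⟩, Subtype.ext hg'.symm⟩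

/-! ### Indices in the chain and compatibility of the weights -/

section index

variable {m : ℕ} {τ : ℤ → ℤ → T.rankTwoSubring}

theorem dvd_of_le (ht : T.IsLocalParameters t₁ t₂)
    (hτ : ∀ i j : ℤ, (0 < j ∨ j = 0 ∧ 0 ≤ i) → T.incl (τ i j) = t₁ ^ i * t₂ ^ j) {i j i' j' : ℤ}
    (h : 0 < j ∨ j = 0 ∧ 0 ≤ i) (h' : j < j' ∨ j = j' ∧ i ≤ i') : τ i j ∣ τ i' j' := by
  refine ⟨τ (i' - i) (j' - j), T.incl_injective ?_⟩
  rw [map_mul, hτ _ _ h, hτ _ _ (by omega), hτ _ _ (by omega), mul_mul_mul_comm,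
    ← zpow_add₀ ht.fst_ne_zero, ← zpow_add₀ ht.snd_ne_zero]
  congr 2 <;> ring

theorem relIndex_add (ht : T.IsLocalParameters t₁ t₂)
    (hτ : ∀ i j : ℤ, (0 < j ∨ j = 0 ∧ 0 ≤ i) → T.incl (τ i j) = t₁ ^ i * t₂ ^ j) (hm : 1 ≤ m)
    {i j : ℤ} (h : PosIndex i j) (n : ℕ) :
    (principal m (τ (i + n) j)).relIndex (principal m (τ i j)) = (T.q ^ (m ^ 2 - 1)) ^ n := by
  rw [posIndex_iff] at h
  have := T.finite_residue
  obtain ⟨π, hπ, -, hker⟩ := ht.exists_incl_eq_fst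
  induction n with
  | zero => simp
  | succ n ih =>
    have hτ0 : τ (i + n) j ≠ 0 := fun h0 => by
      have := hτ (i + n) j (by omega)
      rw [h0, map_zero] at this
      exact mul_ne_zero (zpow_ne_zero _ ht.fst_ne_zero) (zpow_ne_zero _ ht.snd_ne_zero) this.symm
    have hstep : τ (i + (n + 1 : ℕ)) j = τ (i + n) j * π := by
      apply T.incl_injective
      rw [map_mul, hπ, hτ _ _ (by omega), hτ _ _ (by omega), Nat.cast_succ, ← add_assoc,
        zpow_add_one₀ ht.fst_ne_zero]
      ring
    -- Since `(i + n, j) ≥ (1, 0)`, the element is divisible by `t₁`, which generates the kernel of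
    -- the last residue map.
    have hres : T.lastResidue (τ (i + n) j) = 0 := by
      refine (hker _).2 (Dvd.dvd.trans (dvd_of_eq ?_) (dvd_of_le ht hτ (i := 1) (j := 0) ?_ ?_))
      · apply T.incl_injective
        rw [hπ, hτ _ _ (by omega)]
        simp
      · omega
      · omega
    rw [← Subgroup.relIndex_mul_relIndex (principal m (τ (i + (n + 1 : ℕ)) j))
      (principal m (τ (i + n) j)) (principal m (τ i j)), ih, hstep,
      relIndex_principal_mul hm T.lastResidue_surjective T.isUnit_of_lastResidue_eq_one hker hτ0 hres,
      pow_succ' (T.q ^ (m ^ 2 - 1)), q]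
    · exact principal_anti (hstep ▸ dvd_mul_right _ _)
    · exact principal_anti (dvd_of_le ht hτ (by omega) (by omega))

theorem weight_eq_relIndex_smul (ht : T.IsLocalParameters t₁ t₂)
    (hτ : ∀ i j : ℤ, (0 < j ∨ j = 0 ∧ 0 ≤ i) → T.incl (τ i j) = t₁ ^ i * t₂ ^ j) (hm : 1 ≤ m)
    (c : LaurentSeries ℝ) {i j i' j' : ℤ} (h : PosIndex i j) (h' : j < j' ∨ j = j' ∧ i ≤ i')
    (hfin : (principal m (τ i' j')).relIndex (principal m (τ i j)) ≠ 0) :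
    c * HahnSeries.single (((m : ℤ) ^ 2 - 1) * j) ((T.q : ℝ) ^ (-(((m : ℤ) ^ 2 - 1) * i))) =
      (principal m (τ i' j')).relIndex (principal m (τ i j)) •
        (c * HahnSeries.single (((m : ℤ) ^ 2 - 1) * j')
          ((T.q : ℝ) ^ (-(((m : ℤ) ^ 2 - 1) * i')))) := by
  have hq := T.two_le_q
  rcases h' with hj | ⟨rfl, hi⟩
  · rcases hm.eq_or_lt with rfl | hm'
    -- For `m = 1` the group is trivial and the factor `m² - 1` vanishes, so all weights coincide.
    · have hbot : ∀ K : Subgroup (Matrix.SpecialLinearGroup (Fin 1) T.rankTwoSubring), K = ⊤ :=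
        fun K => Subsingleton.elim _ _
      rw [hbot (principal 1 (τ i' j')), Subgroup.relIndex_top_left]
      simp
    · exfalso
      set N := (principal m (τ i' j')).relIndex (principal m (τ i j))
      -- The group at `(i + n, j)` lies between the two for every `n`, so a finite index `N` is
      -- divisible by every power of `q^(m²-1)`. Taking `n = N` contradicts `N < (q^(m²-1))^N`.
      have hdvd : (T.q ^ (m ^ 2 - 1)) ^ N ∣ N := by
        rw [← relIndex_add ht hτ hm h N]
        rw [posIndex_iff] at h
        have h1 := Subgroup.relIndex_mul_relIndex (principal m (τ i' j'))
          (principal m (τ (i + N) j)) (principal m (τ i j))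
          (principal_anti (dvd_of_le ht hτ (by omega) (by omega)))
          (principal_anti (dvd_of_le ht hτ (by omega) (by omega)))
        exact Dvd.intro_left _ h1
      have h2 : 1 < T.q ^ (m ^ 2 - 1) :=
        Nat.one_lt_pow (by have : 2 ^ 2 ≤ m ^ 2 := Nat.pow_le_pow_left hm' 2; omega) hq
      exact absurd (Nat.le_of_dvd (Nat.pos_of_ne_zero hfin) hdvd) (Nat.lt_pow_self h2).not_ge
  · obtain ⟨n, rfl⟩ : ∃ n : ℕ, i' = i + n := ⟨(i' - i).toNat, by omega⟩
    have hq0 : (T.q : ℝ) ≠ 0 := by positivity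
    have hd : ((m ^ 2 - 1 : ℕ) : ℤ) = (m : ℤ) ^ 2 - 1 := by
      have := Nat.one_le_pow 2 m hm
      push_cast [this]; ring
    rw [relIndex_add ht hτ hm h, ← mul_smul_comm, ← hd]
    congr 1
    ext a
    rw [HahnSeries.coeff_nsmul, Pi.smul_apply, HahnSeries.coeff_single, HahnSeries.coeff_single,
      smul_ite, smul_zero, nsmul_eq_mul]
    congr 1
    push_cast
    rw [← pow_mul, ← zpow_natCast, ← zpow_add₀ hq0]
    congr 1
    push_cast
    ring

end index

end TwoDimLocalField

/-! ### The invariant measure on ddd-sets -/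

theorem mainTheorem5 {F : Type*} [Field F] (T : TwoDimLocalField F) (t₁ t₂ : F)
    (ht : T.IsLocalParameters t₁ t₂) (m : ℕ) (hm : 1 ≤ m) (c : (LaurentSeries ℝ)ˣ) :
    ∃ μ : MeasureTheory.AddContent (LaurentSeries ℝ) (T.dddSets m t₁ t₂),
      (∀ (g : Matrix.SpecialLinearGroup (Fin m) F) (i j : ℤ), TwoDimLocalField.PosIndex i j →
        μ (g • T.congruenceSetSL m t₁ t₂ i j) =
          (c : LaurentSeries ℝ) *
            HahnSeries.single (((m : ℤ) ^ 2 - 1) * j) ((T.q : ℝ) ^ (-(((m : ℤ) ^ 2 - 1) * i)))) ∧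
      (∀ (g : Matrix.SpecialLinearGroup (Fin m) F), ∀ A ∈ T.dddSets m t₁ t₂,
        g • A ∈ T.dddSets m t₁ t₂ ∧ μ (g • A) = μ A) ∧
      (∀ ν : MeasureTheory.AddContent (LaurentSeries ℝ) (T.dddSets m t₁ t₂),
        (∀ (g : Matrix.SpecialLinearGroup (Fin m) F) (i j : ℤ), TwoDimLocalField.PosIndex i j →
          ν (g • T.congruenceSetSL m t₁ t₂ i j) = μ (g • T.congruenceSetSL m t₁ t₂ i j)) →
        ∀ A ∈ T.dddSets m t₁ t₂, ν A = μ A) := by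
  choose! τ hτ using fun (i j : ℤ) (h : 0 < j ∨ j = 0 ∧ 0 ≤ i) => ht.exists_incl_eq h
  -- Pairs are stored as `(j, i)`, so that the usual lexicographic order is the order from the
  -- right.
  let Γ := {p : ℤ ×ₗ ℤ // toLex ((0 : ℤ), (0 : ℤ)) < p}
  let K : Γ → Subgroup (Matrix.SpecialLinearGroup (Fin m) T.rankTwoSubring) := fun γ =>
    Matrix.PrincipalCongruence.principal m (τ (ofLex γ.1).2 (ofLex γ.1).1)
  let H : Γ → Subgroup (Matrix.SpecialLinearGroup (Fin m) F) := fun γ =>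
    (K γ).map (Matrix.SpecialLinearGroup.map T.incl)
  let w : Γ → LaurentSeries ℝ := fun γ => (c : LaurentSeries ℝ) *
    HahnSeries.single (((m : ℤ) ^ 2 - 1) * (ofLex γ.1).1) ((T.q : ℝ) ^ (-(((m : ℤ) ^ 2 - 1) * (ofLex γ.1).2)))
  have hpos : ∀ γ : Γ, TwoDimLocalField.PosIndex (ofLex γ.1).2 (ofLex γ.1).1 := fun γ => γ.2
  have hpos' : ∀ γ : Γ, 0 < (ofLex γ.1).1 ∨ (ofLex γ.1).1 = 0 ∧ 0 ≤ (ofLex γ.1).2 := fun γ => by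
    have := TwoDimLocalField.posIndex_iff.1 (hpos γ)
    omega
  have hle : ∀ γ γ' : Γ, γ ≤ γ' → (ofLex γ.1).1 < (ofLex γ'.1).1 ∨
      (ofLex γ.1).1 = (ofLex γ'.1).1 ∧ (ofLex γ.1).2 ≤ (ofLex γ'.1).2 := fun γ γ' h =>
    Prod.Lex.le_iff.1 h
  have hH : Antitone H := fun γ γ' h => Subgroup.map_mono
    (Matrix.PrincipalCongruence.principal_anti
      (TwoDimLocalField.dvd_of_le ht hτ (hpos' γ) (hle γ γ' h)))
  have hinj : Function.Injective (Matrix.SpecialLinearGroup.map (n := Fin m) T.incl) :=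
    fun g g' h => Subtype.ext (Matrix.map_injective T.incl_injective (congrArg Subtype.val h))
  have hw : ∀ γ γ', γ ≤ γ' → (H γ').relIndex (H γ) ≠ 0 → w γ = (H γ').relIndex (H γ) • w γ' := by
    intro γ γ' h
    -- Indices may be computed over the rank two ring, because `SL_m` of it embeds in `SL_m(F)`.
    rw [Subgroup.relIndex_map_map_of_injective _ _ hinj]
    exact TwoDimLocalField.weight_eq_relIndex_smul ht hτ hm c (hpos γ) (hle γ γ' h)
  have hcoe : ∀ γ : Γ, (H γ : Set (Matrix.SpecialLinearGroup (Fin m) F)) =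
      T.congruenceSetSL m t₁ t₂ (ofLex γ.1).2 (ofLex γ.1).1 := fun γ =>
    TwoDimLocalField.coe_map_principal (hτ _ _ (hpos' γ))
  have hS : T.distinguishedSets m t₁ t₂ = SubgroupChain.cosets H := by
    ext D
    constructor
    · rintro ⟨g, i, j, h, rfl⟩
      exact ⟨g, ⟨toLex (j, i), h⟩, by rw [hcoe]; rfl⟩
    · rintro ⟨g, γ, rfl⟩
      exact ⟨g, _, _, hpos γ, by rw [hcoe]⟩
  rw [TwoDimLocalField.dddSets, hS]
  obtain ⟨μ, hμ⟩ := SubgroupChain.exists_addContent hH hw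
  refine ⟨μ, fun g i j h => ?_, fun g A hA => ⟨SubgroupChain.smul_mem_generatedSetRing H g hA,
    SubgroupChain.addContent_smul hH hμ g hA⟩, fun ν hν A hA =>
    addContent_eq_of_eq_on_generators (SubgroupChain.inter_cosets hH) μ ν ?_ hA⟩
  · have := hμ g ⟨toLex (j, i), h⟩
    rwa [hcoe] at this
  · rintro _ ⟨g, γ, rfl⟩
    rw [hcoe]
    exact hν g _ _ (hpos γ)
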